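/- **Conventions.** A fuzzy order on a set $X$ is a map $\mu:X\times X\to[0,1]$ with $\mu(x,x)=1$; $\mu(x,y)+\mu(y,x)>1\Rightarrow x=y$; and $\mu(x,z)\ge\bigvee_{y}[\mu(x,y)\wedge\mu(y,z)]$. Write $x\preceq y$ for $\mu(x,y)>\tfrac12$. Upper and lower bounds, suprema and infima, boundedness, and monotonicity of sequences and nets are understood with respect to $\preceq$; $x_\alpha\uparrow x$ (resp. $x_\alpha\downarrow x$) means increasing with supremum $x$ (resp. decreasing with infimum $x$). A fuzzy ordered linear space is a real vector space with a fuzzy order such that $\mu(x_1,x_2)>\tfrac12$ implies $\mu(x_1,x_2)\le\mu(x_1+x,x_2+x)$ for all $x$ and $\mu(x_1,x_2)\le\mu(ax_1,ax_2)$ for all real $a>0$. It is a fuzzy Riesz space if any two elements have a supremum and an infimum; put $|x|=x\vee(-x)$. It is fuzzy Dedekind complete if every nonempty subset that is bounded above has a supremum. A fuzzy ideal is a vector subspace $A$ such that $|x|\preceq|y|$ and $y\in A$ imply $x\in A$. A fuzzy ideal $A$ is a fuzzy band if $\sup D\in A$ whenever $D\subseteq A$ and $\sup D$ exists in the whole space;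 it is a fuzzy $\sigma$-ideal if $x_n\in A$, $0\preceq x_n$ and $x_n\uparrow x$ imply $x\in A$. The fuzzy ideal generated by an element is the smallest fuzzy ideal containing it. A net $(x_\alpha)$ is fuzzy order convergent to $x$ if there is a net $(y_\alpha)$ with the same index set such that $|x_\alpha-x|\preceq y_\alpha$ for all $\alpha$ and $y_\alpha\downarrow0$. A linear operator $T:E\to F$ between fuzzy Riesz spaces is fuzzy order continuous (resp. fuzzy $\sigma$-order continuous) if for every net (resp. sequence) that is fuzzy order convergent to $0$ in $E$, its image under $T$ is fuzzy order convergent to $0$ in $F$. It is fuzzy positive if $0\preceq x$ implies $0\preceq Tx$, and fuzzy order bounded if it maps bounded sets to bounded sets. $FL_b(E,F)$ is the vector space of fuzzy order bounded linear operators $E\to F$, with the fuzzy order of grade $1$ if $S=T$, $\tfrac23$ if $S\ne T$ and $T-S$ is fuzzy positive, and $0$ otherwise. When $F$ is fuzzy Dedekind complete, every $S\in FL_b(E,F)$ has a modulus $|S|=S\vee(-S)$ in $FL_b(E,F)$; its null ideal is $N_S=\{x\in E:\ |S|(|x|)=0\}$. **Theorem 4.7.** Let $E$ and $F$ be fuzzy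 Riesz spaces with $F$ fuzzy Dedekind complete, let $T:E\to F$ be a fuzzy order bounded linear operator, and let $A_T$ be the fuzzy ideal generated by $T$ in $FL_b(E,F)$. Then: 1. $T$ is fuzzy order continuous if and only if $N_S$ is a fuzzy band in $E$ for every $S\in A_T$. 2. $T$ is fuzzy $\sigma$-order continuous if and only if $N_S$ is a fuzzy $\sigma$-ideal in $E$ for every $S\in A_T$. -/

import Mathlib

universe u v w

noncomputable section

namespace FuzzyRiesz

open scoped unitInterval

/-! ### Fuzzy ordered sets -/

/-- A fuzzy order on `E`, given by its membership function `μ : E × E → [0,1]`.  Transitivity,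
`μ(x,z) ≥ ⋁_y [μ(x,y) ∧ μ(y,z)]`, uses the supremum of the complete lattice `[0,1]`. -/
class FuzzyOrder (E : Type*) where
  /-- the membership function -/
  mu : E → E → I
  mu_refl : ∀ x, mu x x = 1
  mu_antisymm : ∀ x y, (mu x y : ℝ) + (mu y x : ℝ) > 1 → x = y
  mu_trans : ∀ x z, ⨆ y, mu x y ⊓ mu y z ≤ mu x z

section Order

variable {E : Type*} [FuzzyOrder E]

/-- The relation `μ(x,y) > 1/2`. -/
def FLE (x y : E) : Prop := (1 / 2 : ℝ) < (FuzzyOrder.mu x y : ℝ)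

theorem FLE.refl (x : E) : FLE x x := by
  unfold FLE
  rw [FuzzyOrder.mu_refl]
  norm_num

theorem FLE.trans {x y z : E} (h₁ : FLE x y) (h₂ : FLE y z) : FLE x z := by
  have h := (le_iSup (fun w => FuzzyOrder.mu x w ⊓ FuzzyOrder.mu w z) y).trans
    (FuzzyOrder.mu_trans x z)
  unfold FLE at *
  rcases inf_le_iff.1 h with h | h
  · exact lt_of_lt_of_le h₁ h
  · exact lt_of_lt_of_le h₂ h

theorem FLE.antisymm {x y : E} (h₁ : FLE x y) (h₂ : FLE y x) : x = y :=
  FuzzyOrder.mu_antisymm x y (by unfold FLE at *; linarith)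

open Classical in
/-- The upper bound `U(A)`, a fuzzy set on `E`. -/
def upperBound (A : Set E) (y : E) : I :=
  if ∃ x ∈ A, (FuzzyOrder.mu x y : ℝ) ≤ 1 / 2 then 0 else ⨅ x ∈ A, FuzzyOrder.mu x y

open Classical in
/-- The lower bound `L(A)`, a fuzzy set on `E`. -/
def lowerBound (A : Set E) (y : E) : I :=
  if ∃ x ∈ A, (FuzzyOrder.mu y x : ℝ) ≤ 1 / 2 then 0 else ⨅ x ∈ A, FuzzyOrder.mu y x

/-- `y ∈ U(A)`, that is, `U(A)(y) > 0`: `y` is an upper bound of `A`. -/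
def IsUpper (A : Set E) (y : E) : Prop := 0 < upperBound A y

/-- `y ∈ L(A)`, that is, `L(A)(y) > 0`: `y` is a lower bound of `A`. -/
def IsLower (A : Set E) (y : E) : Prop := 0 < lowerBound A y

theorem half_le_iInf {ι : Type*} (A : Set ι) (f : ι → I) (h : ∀ x ∈ A, (1 / 2 : ℝ) < (f x : ℝ)) :
    0 < ⨅ x ∈ A, f x := by
  have hh : (⟨1 / 2, by norm_num, by norm_num⟩ : I) ≤ ⨅ x ∈ A, f x :=
    le_iInf₂ fun x hx => (h x hx).le
  refine lt_of_lt_of_le ?_ hh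
  show (0 : ℝ) < 1 / 2
  norm_num

theorem isUpper_iff {A : Set E} {y : E} : IsUpper A y ↔ ∀ x ∈ A, FLE x y := by
  unfold IsUpper upperBound
  split_ifs with h
  · obtain ⟨x, hx, hxy⟩ := h
    exact ⟨fun h => absurd h (lt_irrefl _), fun h => absurd (h x hx) (not_lt.2 hxy)⟩
  · push Not at h
    exact ⟨fun _ => h, fun _ => half_le_iInf A _ h⟩

theorem isLower_iff {A : Set E} {y : E} : IsLower A y ↔ ∀ x ∈ A, FLE y x := by
  unfold IsLower lowerBound
  split_ifs with h
  · obtain ⟨x, hx, hxy⟩ := h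
    exact ⟨fun h => absurd h (lt_irrefl _), fun h => absurd (h x hx) (not_lt.2 hxy)⟩
  · push Not at h
    exact ⟨fun _ => h, fun _ => half_le_iInf A _ h⟩

/-- `z = sup A`. -/
def IsFSup (A : Set E) (z : E) : Prop := IsUpper A z ∧ ∀ y, IsUpper A y → IsUpper {z} y

/-- `z = inf A`. -/
def IsFInf (A : Set E) (z : E) : Prop := IsLower A z ∧ ∀ y, IsLower A y → IsLower {z} y

theorem isFSup_iff {A : Set E} {z : E} :
    IsFSup A z ↔ (∀ x ∈ A, FLE x z) ∧ ∀ y, (∀ x ∈ A, FLE x y) → FLE z y := by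
  simp [IsFSup, isUpper_iff]

theorem isFInf_iff {A : Set E} {z : E} :
    IsFInf A z ↔ (∀ x ∈ A, FLE z x) ∧ ∀ y, (∀ x ∈ A, FLE y x) → FLE y z := by
  simp [IsFInf, isLower_iff]

theorem IsFSup.unique {A : Set E} {z w : E} (hz : IsFSup A z) (hw : IsFSup A w) : z = w := by
  rw [isFSup_iff] at hz hw
  exact (hz.2 w hw.1).antisymm (hw.2 z hz.1)

/-- `A` is bounded: it is bounded from above and from below. -/
def FBounded (A : Set E) : Prop := (∃ y, IsUpper A y) ∧ ∃ y, IsLower A y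

/-- `x_n ↑ x`: the sequence is increasing with supremum `x`. -/
def IncreasesTo (x : ℕ → E) (l : E) : Prop :=
  (∀ m n, m ≤ n → FLE (x m) (x n)) ∧ IsFSup (Set.range x) l

/-- `y_α ↓ l`: the net is decreasing with infimum `l`. -/
def DecreasesTo {ι : Type*} [Preorder ι] (y : ι → E) (l : E) : Prop :=
  (∀ α β, α ≤ β → FLE (y β) (y α)) ∧ IsFInf (Set.range y) l

end Order

/-- Every nonempty subset that is bounded above has a supremum. -/
def FuzzyDedekindComplete (E : Type*) [FuzzyOrder E] : Prop :=
  ∀ A : Set E, A.Nonempty → (∃ y, IsUpper A y) → ∃ z, IsFSup A z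

/-! ### Fuzzy ordered linear spaces and fuzzy Riesz spaces -/

/-- A fuzzy ordered (real) linear space. -/
class FuzzyOrderedSpace (E : Type*) [AddCommGroup E] [Module ℝ E] extends FuzzyOrder E where
  mu_add : ∀ x₁ x₂ : E, (1 / 2 : ℝ) < (mu x₁ x₂ : ℝ) → ∀ x, mu x₁ x₂ ≤ mu (x₁ + x) (x₂ + x)
  mu_smul : ∀ x₁ x₂ : E, (1 / 2 : ℝ) < (mu x₁ x₂ : ℝ) → ∀ a : ℝ, 0 < a →
    mu x₁ x₂ ≤ mu (a • x₁) (a • x₂)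

/-- A fuzzy Riesz space: a fuzzy ordered linear space in which any two elements have a supremum
and an infimum. -/
class FuzzyRieszSpace (E : Type*) [AddCommGroup E] [Module ℝ E] extends FuzzyOrderedSpace E where
  exists_sup : ∀ x y : E, ∃ z, IsFSup {x, y} z
  exists_inf : ∀ x y : E, ∃ z, IsFInf {x, y} z

section Space

variable {E : Type*} [AddCommGroup E] [Module ℝ E]

theorem FLE.add_right [FuzzyOrderedSpace E] {x y : E} (h : FLE x y) (z : E) :
    FLE (x + z) (y + z) :=
  lt_of_lt_of_le h (FuzzyOrderedSpace.mu_add x y h z)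

theorem FLE.smul [FuzzyOrderedSpace E] {x y : E} (h : FLE x y) {a : ℝ} (ha : 0 < a) :
    FLE (a • x) (a • y) :=
  lt_of_lt_of_le h (FuzzyOrderedSpace.mu_smul x y h a ha)

theorem FLE.add [FuzzyOrderedSpace E] {x y z w : E} (h : FLE x y) (h' : FLE z w) :
    FLE (x + z) (y + w) := by
  have := h'.add_right y
  rw [add_comm z, add_comm w] at this
  exact (h.add_right z).trans this

theorem FLE.neg [FuzzyOrderedSpace E] {x y : E} (h : FLE x y) : FLE (-y) (-x) := by
  have := h.add_right (-x - y)
  rwa [show x + (-x - y) = -y by abel, show y + (-x - y) = -x by abel] at this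

/-- `a = |x|`, that is, `a = x ∨ (-x)`, in a fuzzy ordered linear space in which the supremum of
`{x, -x}` may or may not exist. -/
def IsFAbs [FuzzyOrderedSpace E] (x a : E) : Prop := IsFSup {x, -x} a

/-- The lattice operation `x ∨ y`. -/
def fsup [FuzzyRieszSpace E] (x y : E) : E := (FuzzyRieszSpace.exists_sup x y).choose

theorem fsup_spec [FuzzyRieszSpace E] (x y : E) : IsFSup {x, y} (fsup x y) :=
  (FuzzyRieszSpace.exists_sup x y).choose_spec

/-- The absolute value `|x| = x ∨ (-x)`. -/
def fabs [FuzzyRieszSpace E] (x : E) : E := fsup x (-x)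

theorem isFAbs_iff [FuzzyRieszSpace E] {x a : E} : IsFAbs x a ↔ a = fabs x :=
  ⟨fun h => h.unique (fsup_spec x (-x)), fun h => h ▸ fsup_spec x (-x)⟩

/-! ### Ideals, σ-ideals, bands -/

/-- `A` is fuzzy solid: `μ(|x|,|y|) > 1/2` and `y ∈ A` imply `x ∈ A`. -/
def FuzzySolid [FuzzyOrderedSpace E] (A : Set E) : Prop :=
  ∀ x y a b : E, IsFAbs x a → IsFAbs y b → FLE a b → y ∈ A → x ∈ A

/-- A fuzzy ideal: a fuzzy solid vector subspace. -/
def IsFuzzyIdeal [FuzzyOrderedSpace E] (A : Set E) : Prop :=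
  (∃ K : Submodule ℝ E, (K : Set E) = A) ∧ FuzzySolid A

/-- The fuzzy ideal generated by `D`: the intersection of all fuzzy ideals that contain `D`. -/
def idealGenerated [FuzzyOrderedSpace E] (D : Set E) : Set E :=
  ⋂₀ {A | IsFuzzyIdeal A ∧ D ⊆ A}

/-- The fuzzy ideal generated by `D` is the smallest fuzzy ideal that contains `D`. -/
theorem idealGenerated_isLeast [FuzzyOrderedSpace E] (D : Set E) :
    IsLeast {A : Set E | IsFuzzyIdeal A ∧ D ⊆ A} (idealGenerated D) := by
  refine ⟨⟨⟨⟨sInf {K : Submodule ℝ E | IsFuzzyIdeal (K : Set E) ∧ D ⊆ K}, ?_⟩, ?_⟩, ?_⟩, ?_⟩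
  · ext x
    simp only [idealGenerated, Submodule.coe_sInf, Set.mem_iInter, Set.mem_sInter,
      Set.mem_ofPred_eq, SetLike.mem_coe]
    constructor
    · rintro h A ⟨hA, hD⟩
      obtain ⟨K, rfl⟩ := hA.1
      exact h K ⟨hA, hD⟩
    · intro h K hK
      exact h K hK
  · intro x y a b hx hy hab hyA A hA
    exact hA.1.2 x y a b hx hy hab (hyA A hA)
  · exact Set.subset_sInter fun A hA => hA.2
  · exact fun A hA => Set.sInter_subset_of_mem hA

/-- A fuzzy σ-ideal: a fuzzy ideal `A` such that `x_n ∈ A⁺` and `x_n ↑ x` imply `x ∈ A`. -/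
def IsFuzzySigmaIdeal [FuzzyOrderedSpace E] (A : Set E) : Prop :=
  IsFuzzyIdeal A ∧ ∀ (x : ℕ → E) (l : E), (∀ n, x n ∈ A ∧ FLE 0 (x n)) → IncreasesTo x l → l ∈ A

/-- A fuzzy band: a fuzzy ideal that contains the supremum of each of its subsets whenever that
supremum exists in the whole space. -/
def IsFuzzyBand [FuzzyOrderedSpace E] (A : Set E) : Prop :=
  IsFuzzyIdeal A ∧ ∀ (D : Set E) (z : E), D ⊆ A → IsFSup D z → z ∈ A

/-! ### Order convergence -/

/-- The net `x` is fuzzy order convergent to `l`: `μ(|x_α - l|, y_α) > 1/2` for some net `y_α ↓ 0`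
with the same index set. -/
def OrderConverges [FuzzyRieszSpace E] {ι : Type*} [Preorder ι] (x : ι → E) (l : E) : Prop :=
  ∃ y : ι → E, (∀ α, FLE (fabs (x α - l)) (y α)) ∧ DecreasesTo y 0

end Space

section Operators

variable {E : Type u} {F : Type v} [AddCommGroup E] [Module ℝ E] [FuzzyRieszSpace E]
  [AddCommGroup F] [Module ℝ F] [FuzzyRieszSpace F]

/-- Fuzzy order continuity, tested on all nets indexed by directed sets in the universe `w`. -/
def FuzzyOrderContinuous (T : E →ₗ[ℝ] F) : Prop :=
  ∀ (ι : Type w) [Preorder ι] [IsDirectedOrder ι] [Nonempty ι] (x : ι → E),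
    OrderConverges x 0 → OrderConverges (fun α => T (x α)) 0

/-- Fuzzy σ-order continuity, tested on sequences. -/
def FuzzySigmaOrderContinuous (T : E →ₗ[ℝ] F) : Prop :=
  ∀ x : ℕ → E, OrderConverges x 0 → OrderConverges (fun n => T (x n)) 0

/-- `T` is fuzzy positive. -/
def FuzzyPositive (T : E →ₗ[ℝ] F) : Prop := ∀ x, FLE 0 x → FLE 0 (T x)

/-- `T` is fuzzy order bounded: it maps bounded sets to bounded sets. -/
def FuzzyOrderBounded (T : E →ₗ[ℝ] F) : Prop := ∀ C : Set E, FBounded C → FBounded (T '' C)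

theorem FuzzyOrderBounded.add {S T : E →ₗ[ℝ] F} (hS : FuzzyOrderBounded S)
    (hT : FuzzyOrderBounded T) : FuzzyOrderBounded (S + T) := by
  intro C hC
  obtain ⟨⟨a, ha⟩, ⟨b, hb⟩⟩ := hS C hC
  obtain ⟨⟨c, hc⟩, ⟨d, hd⟩⟩ := hT C hC
  rw [isUpper_iff] at ha hc
  rw [isLower_iff] at hb hd
  refine ⟨⟨a + c, isUpper_iff.2 ?_⟩, ⟨b + d, isLower_iff.2 ?_⟩⟩
  · rintro _ ⟨x, hx, rfl⟩
    exact (ha _ ⟨x, hx, rfl⟩).add (hc _ ⟨x, hx, rfl⟩)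
  · rintro _ ⟨x, hx, rfl⟩
    exact (hb _ ⟨x, hx, rfl⟩).add (hd _ ⟨x, hx, rfl⟩)

theorem FuzzyOrderBounded.smul {T : E →ₗ[ℝ] F} (hT : FuzzyOrderBounded T) (a : ℝ) :
    FuzzyOrderBounded (a • T) := by
  intro C hC
  obtain ⟨⟨c, hc⟩, ⟨d, hd⟩⟩ := hT C hC
  rw [isUpper_iff] at hc
  rw [isLower_iff] at hd
  rcases lt_trichotomy a 0 with ha | rfl | ha
  · have key : ∀ x y : F, FLE x y → FLE (a • y) (a • x) := fun x y h => by
      have := (h.smul (neg_pos.2 ha)).neg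
      simpa using this
    refine ⟨⟨a • d, isUpper_iff.2 ?_⟩, ⟨a • c, isLower_iff.2 ?_⟩⟩
    · rintro _ ⟨x, hx, rfl⟩
      exact key _ _ (hd _ ⟨x, hx, rfl⟩)
    · rintro _ ⟨x, hx, rfl⟩
      exact key _ _ (hc _ ⟨x, hx, rfl⟩)
  · refine ⟨⟨0, isUpper_iff.2 ?_⟩, ⟨0, isLower_iff.2 ?_⟩⟩ <;>
    · rintro _ ⟨x, hx, rfl⟩
      simpa using FLE.refl (0 : F)
  · refine ⟨⟨a • c, isUpper_iff.2 ?_⟩, ⟨a • d, isLower_iff.2 ?_⟩⟩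
    · rintro _ ⟨x, hx, rfl⟩
      exact (hc _ ⟨x, hx, rfl⟩).smul ha
    · rintro _ ⟨x, hx, rfl⟩
      exact (hd _ ⟨x, hx, rfl⟩).smul ha

variable (E F) in
/-- `FL_b(E,F)`: the vector space of all fuzzy order bounded linear operators `E → F`. -/
def FLb : Submodule ℝ (E →ₗ[ℝ] F) where
  carrier := {T | FuzzyOrderBounded T}
  add_mem' hS hT := hS.add hT
  zero_mem' := by
    refine fun C _ => ⟨⟨0, isUpper_iff.2 ?_⟩, ⟨0, isLower_iff.2 ?_⟩⟩ <;>
    · rintro _ ⟨x, hx, rfl⟩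
      exact FLE.refl 0
  smul_mem' a _ hT := hT.smul a

theorem FuzzyPositive.eq_zero {T : E →ₗ[ℝ] F} (h₁ : FuzzyPositive T) (h₂ : FuzzyPositive (-T)) :
    T = 0 := by
  have key : ∀ x, FLE 0 x → T x = 0 := fun x hx => by
    have h := (h₂ x hx).neg
    simp only [LinearMap.neg_apply, neg_neg, neg_zero] at h
    exact h.antisymm (h₁ x hx)
  ext x
  have hs := (isFSup_iff.1 (fsup_spec x 0)).1
  have e₁ := key _ (hs 0 (by simp))
  have e₂ := key (fsup x 0 - x) (by
    have := (hs x (by simp)).add_right (-x)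
    simpa [sub_eq_add_neg] using this)
  rw [map_sub, e₁, zero_sub, neg_eq_zero] at e₂
  simpa using e₂

theorem FuzzyPositive.add {S T : E →ₗ[ℝ] F} (hS : FuzzyPositive S) (hT : FuzzyPositive T) :
    FuzzyPositive (S + T) := fun x hx => by
  simpa using (hS x hx).add (hT x hx)

theorem FuzzyPositive.smul {T : E →ₗ[ℝ] F} (hT : FuzzyPositive T) {a : ℝ} (ha : 0 < a) :
    FuzzyPositive (a • T) := fun x hx => by
  simpa using (hT x hx).smul ha

open Classical in
/-- The membership function of the operator order `S ≤ T ↔ T - S` is fuzzy positive: the grade is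
`1` if `S = T`, `2/3` if `S ≤ T` and `S ≠ T`, and `0` otherwise. -/
def opMu (S T : FLb E F) : I :=
  if S = T then 1
  else if FuzzyPositive ((T : E →ₗ[ℝ] F) - (S : E →ₗ[ℝ] F)) then ⟨2 / 3, by norm_num, by norm_num⟩
  else 0

theorem FuzzyPositive.zero : FuzzyPositive (0 : E →ₗ[ℝ] F) := fun _ _ => FLE.refl 0

theorem half_lt_opMu_iff {S T : FLb E F} :
    (1 / 2 : ℝ) < (opMu S T : ℝ) ↔ FuzzyPositive ((T : E →ₗ[ℝ] F) - (S : E →ₗ[ℝ] F)) := by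
  unfold opMu
  split_ifs with h₁ h₂
  · subst h₁
    rw [sub_self]
    exact ⟨fun _ => FuzzyPositive.zero, fun _ => by norm_num⟩
  · exact ⟨fun _ => h₂, fun _ => by norm_num⟩
  · exact ⟨fun h => by norm_num at h, fun h => absurd h h₂⟩

theorem opMu_le_of_imp {S T S' T' : FLb E F} (h₁ : S = T → S' = T')
    (h₂ : FuzzyPositive ((T : E →ₗ[ℝ] F) - (S : E →ₗ[ℝ] F)) →
      FuzzyPositive ((T' : E →ₗ[ℝ] F) - (S' : E →ₗ[ℝ] F))) :
    opMu S T ≤ opMu S' T' := by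
  by_cases e' : S' = T'
  · rw [opMu, opMu, if_pos e']
    exact unitInterval.le_one'
  · have e : ¬ S = T := fun e => e' (h₁ e)
    rw [opMu, opMu, if_neg e', if_neg e]
    by_cases p : FuzzyPositive ((T : E →ₗ[ℝ] F) - (S : E →ₗ[ℝ] F))
    · rw [if_pos p, if_pos (h₂ p)]
    · rw [if_neg p]
      exact unitInterval.nonneg'

instance : FuzzyOrderedSpace (FLb E F) where
  mu := opMu
  mu_refl S := by simp [opMu]
  mu_antisymm S T h := by
    by_contra hne
    have hne' : ¬ T = S := fun e => hne e.symm
    have b₁ : (opMu S T : ℝ) ≤ 2 / 3 := by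
      unfold opMu
      rw [if_neg hne]
      split_ifs <;> norm_num
    have b₂ : (opMu T S : ℝ) ≤ 2 / 3 := by
      unfold opMu
      rw [if_neg hne']
      split_ifs <;> norm_num
    rcases le_or_gt (opMu S T : ℝ) (1 / 2) with h₁ | h₁
    · have : (1 / 2 : ℝ) < opMu T S := by linarith
      have p₂ := half_lt_opMu_iff.1 this
      rcases le_or_gt (opMu S T : ℝ) 0 with h₀ | h₀
      · linarith
      · unfold opMu at h₀ h₁
        rw [if_neg hne] at h₀ h₁
        split_ifs at h₀ h₁
        · norm_num at h₁
        · norm_num at h₀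
    · rcases le_or_gt (opMu T S : ℝ) (1 / 2) with h₂ | h₂
      · rcases le_or_gt (opMu T S : ℝ) 0 with h₀ | h₀
        · linarith
        · unfold opMu at h₀ h₂
          rw [if_neg hne'] at h₀ h₂
          split_ifs at h₀ h₂
          · norm_num at h₂
          · norm_num at h₀
      · have p₁ := half_lt_opMu_iff.1 h₁
        have p₂ := half_lt_opMu_iff.1 h₂
        refine hne (Subtype.ext ?_)
        have := p₁.eq_zero (by rwa [neg_sub])
        exact (sub_eq_zero.1 this).symm
  mu_trans R T := by
    refine iSup_le fun S => ?_
    by_cases e₁ : R = S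
    · subst e₁
      exact inf_le_right
    by_cases e₂ : S = T
    · subst e₂
      exact inf_le_left
    by_cases p₁ : FuzzyPositive ((S : E →ₗ[ℝ] F) - (R : E →ₗ[ℝ] F))
    · by_cases p₂ : FuzzyPositive ((T : E →ₗ[ℝ] F) - (S : E →ₗ[ℝ] F))
      · refine inf_le_left.trans ?_
        have p := p₂.add p₁
        rw [sub_add_sub_cancel] at p
        by_cases e : R = T
        · rw [opMu, opMu, if_pos e]
          exact unitInterval.le_one'
        · rw [opMu, opMu, if_neg e₁, if_neg e, if_pos p₁, if_pos p]
      · refine inf_le_right.trans ?_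
        rw [opMu, if_neg e₂, if_neg p₂]
        exact unitInterval.nonneg'
    · refine inf_le_left.trans ?_
      rw [opMu, if_neg e₁, if_neg p₁]
      exact unitInterval.nonneg'
  mu_add S T _ R := by
    refine opMu_le_of_imp (fun h => by rw [h]) fun h => ?_
    simpa using h
  mu_smul S T _ a ha := by
    refine opMu_le_of_imp (fun h => by rw [h]) fun h => ?_
    have := h.smul ha
    rwa [smul_sub] at this

/-- In `FL_b(E,F)`, `μ(S,T) > 1/2` means that `T - S` is a fuzzy positive operator. -/
theorem fle_FLb_iff {S T : FLb E F} :
    FLE S T ↔ FuzzyPositive ((T : E →ₗ[ℝ] F) - (S : E →ₗ[ℝ] F)) :=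
  half_lt_opMu_iff

/-- The null ideal `N_S = {x | |S|(|x|) = 0}`.  Here `|S| = S ∨ (-S)` is the modulus of `S` in
`FL_b(E,F)`; it is unique, and it exists when `F` is fuzzy Dedekind complete. -/
def nullIdeal (S : FLb E F) : Set E :=
  {x | ∃ A : FLb E F, IsFAbs S A ∧ (A : E →ₗ[ℝ] F) (fabs x) = 0}

end Operators

end FuzzyRiesz

end

/-!
The relation `FLE` makes a fuzzy Riesz space an ordinary vector lattice, with the same suprema,
bounds, absolute values and order convergence, and a fuzzy Dedekind complete one a conditionally
complete lattice.  So the theorem is one about an order bounded operator `T : E → F` between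
vector lattices.  Both parts come from one argument for nets indexed by a fixed directed set `ι`;
part 2 is the case `ι = ℕ`.

*Order continuity gives closed null ideals.*  The modulus `|T|` is given by the Riesz–Kantorovich
formula `|T| x = sup {T y | |y| ≤ x}`.  Truncating `y` along a net `x_α ↓ 0` shows that `|T|` is
order continuous together with `T` (`decreasesToZero_modulus`).  Every `S ∈ A_T` satisfies
`|S| ≤ c |T|` for some `c > 0`, since the operators dominated in this way form a fuzzy ideal; so
`|S|` is order continuous too, and then its null ideal contains the suprema of its increasing nets
(`map_abs_eq_zero_of_isLUB`).  For bands, an arbitrary subset of `N_S` with supremum `z` is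
replaced by the upward directed set of all `d ∈ N_S` with `d ≤ z`.

*Closed null ideals give order continuity.*  It suffices to show `|T| y_α ↓ 0` whenever `y_α ↓ 0`.
Fix an index `k`, put `x = y_k`, and let `ε > 0`.  Let `R_α z = sup_t |T| (z ⊓ t u_α)` be the
component of `|T|` carried by `u_α = (y_α - ε x)⁺`, and `S = inf_α R_α`.  Then `0 ≤ S ≤ |T|`, so
`S ∈ A_T`, and `S` vanishes on the elements `(ε x - y_α)⁺`, which are disjoint from `u_α` and
increase to `ε x`.  Hence `S x = 0`.  As `|T| y_α ≤ R_α x + ε |T| x` for `α ≥ k`, a lower bound of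
the net `|T| y_α` is at most `ε |T| x` for every `ε > 0`, hence at most `0`, because `F` is
Archimedean (`decreasesToZero_map_of_kernels`).  Only `F` needs to be Archimedean.
-/

namespace RieszOperator

/-! ### Inequalities in vector lattices -/

section LatticeGroup

variable {E : Type*} [AddCommGroup E] [Lattice E] [IsOrderedAddMonoid E]

theorem abs_truncation_le (y : E) {a : E} (ha : 0 ≤ a) : |(y ⊓ a) ⊔ -a| ≤ a :=
  abs_le'.2 ⟨sup_le inf_le_right ((neg_nonpos.2 ha).trans ha), neg_le.1 le_sup_right⟩

/-- If `|y| ≤ x`, truncating `y` at the level `a ≤ x` changes it by at most `x - a`. -/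
theorem abs_sub_truncation_le {x y a : E} (hy : |y| ≤ x) (hax : a ≤ x) :
    |y - ((y ⊓ a) ⊔ -a)| ≤ x - a := by
  have h₁ : y ≤ x := (le_abs_self y).trans hy
  have h₂ : -y ≤ x := (neg_le_abs y).trans hy
  have h₀ : 0 ≤ x - a := sub_nonneg.2 hax
  refine abs_le'.2 ⟨?_, ?_⟩
  · have : y - (x - a) ≤ (y ⊓ a) ⊔ -a := by
      refine le_trans (le_inf ?_ ?_) le_sup_left
      · exact sub_le_self _ h₀
      · rw [sub_le_iff_le_add]; simpa using h₁
    exact sub_le_comm.1 this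
  · rw [neg_sub, sub_le_iff_le_add]
    refine sup_le (inf_le_left.trans (le_add_of_nonneg_left h₀)) ?_
    have := add_le_add_left h₂ (y - a)
    rw [show x - a + y = x + (y - a) by abel]
    refine le_trans (le_of_eq ?_) this
    abel

theorem add_inf_le_inf_add_inf {y z a : E} (hy : 0 ≤ y) (hz : 0 ≤ z) (ha : 0 ≤ a) :
    (y + z) ⊓ a ≤ y ⊓ a + z ⊓ a := by
  rw [inf_add, add_inf, add_inf]
  refine le_inf (le_inf inf_le_left ?_) (le_inf ?_ ?_)
  · exact inf_le_right.trans (le_add_of_nonneg_left hy)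
  · exact inf_le_right.trans (le_add_of_nonneg_right hz)
  · exact inf_le_right.trans (le_add_of_nonneg_left ha)

theorem inf_add_inf_le_add_inf_add (y z a b : E) : y ⊓ a + z ⊓ b ≤ (y + z) ⊓ (a + b) :=
  le_inf (add_le_add inf_le_left inf_le_left) (add_le_add inf_le_right inf_le_right)

end LatticeGroup

section VectorLattice

variable {E : Type*} [AddCommGroup E] [Lattice E] [Module ℝ E] [PosSMulMono ℝ E]

theorem smul_inf_of_pos {a : ℝ} (ha : 0 < a) (x y : E) : a • (x ⊓ y) = a • x ⊓ a • y := by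
  refine le_antisymm (le_inf (smul_le_smul_of_nonneg_left inf_le_left ha.le)
    (smul_le_smul_of_nonneg_left inf_le_right ha.le)) ?_
  rw [← inv_smul_le_iff_of_pos ha]
  exact le_inf ((inv_smul_le_iff_of_pos ha).2 inf_le_left)
    ((inv_smul_le_iff_of_pos ha).2 inf_le_right)

theorem abs_smul_le (a : ℝ) (x : E) : |a • x| ≤ |a| • |x| := by
  have key : ∀ y : E, y ≤ |x| → -y ≤ |x| → a • y ≤ |a| • |x| := fun y h₁ h₂ => by
    rcases le_total 0 a with ha | ha
    · rw [abs_of_nonneg ha]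
      exact smul_le_smul_of_nonneg_left h₁ ha
    · rw [abs_of_nonpos ha, ← neg_smul_neg a y]
      exact smul_le_smul_of_nonneg_left h₂ (neg_nonneg.2 ha)
  refine abs_le'.2 ⟨key x (le_abs_self x) (neg_le_abs x), ?_⟩
  rw [← smul_neg]
  exact key (-x) (neg_le_abs x) (by simpa using le_abs_self x)

variable [IsOrderedAddMonoid E]

/-- If `u ⊓ v = 0` with `v ≥ 0`, then `v` is disjoint from every positive multiple of `u`. -/
theorem inf_smul_eq_zero {u v : E} (hu : 0 ≤ u) (hv : 0 ≤ v) (h : u ⊓ v = 0) {t : ℝ}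
    (ht : 0 ≤ t) : v ⊓ t • u = 0 := by
  have hs : 0 < max t 1 := lt_max_of_lt_right one_pos
  refine le_antisymm ?_ (le_inf hv (smul_nonneg ht hu))
  have h0 : (max t 1) • (v ⊓ u) = 0 := by rw [inf_comm, h, smul_zero]
  rw [← h0, smul_inf_of_pos hs]
  refine inf_le_inf ?_ ?_
  · have := smul_le_smul_of_nonneg_left hv (sub_nonneg.2 (le_max_right t 1))
    rw [smul_zero, sub_smul, one_smul] at this
    exact sub_nonneg.1 this
  · have := smul_le_smul_of_nonneg_left hu (sub_nonneg.2 (le_max_left t 1))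
    rw [smul_zero, sub_smul] at this
    exact sub_nonneg.1 this

end VectorLattice

/-! ### Construction of operators from their values on the positive cone -/

section Extension

variable {E F : Type*} [AddCommGroup E] [Module ℝ E] [Lattice E] [IsOrderedAddMonoid E]
  [PosSMulMono ℝ E] [AddCommGroup F] [Module ℝ F] [PartialOrder F] [PosSMulMono ℝ F]

/-- An additive, positively homogeneous map on the positive cone extends to a linear operator,
`x ↦ g x⁺ - g x⁻`.  Subhomogeneity is enough: the reverse inequality is subhomogeneity for
`a⁻¹`. -/
theorem exists_linearMap_eq_on_nonneg (g : E → F)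
    (hadd : ∀ x y, 0 ≤ x → 0 ≤ y → g (x + y) = g x + g y)
    (hsmul_le : ∀ (a : ℝ) x, 0 < a → 0 ≤ x → g (a • x) ≤ a • g x) :
    ∃ L : E →ₗ[ℝ] F, ∀ x, 0 ≤ x → L x = g x := by
  have hsmul : ∀ (a : ℝ) x, 0 < a → 0 ≤ x → g (a • x) = a • g x := fun a x ha hx => by
    refine le_antisymm (hsmul_le a x ha hx) ?_
    rw [← le_inv_smul_iff_of_pos ha]
    simpa [smul_smul, inv_mul_cancel₀ ha.ne'] using
      hsmul_le a⁻¹ (a • x) (inv_pos.2 ha) (smul_nonneg ha.le hx)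
  have g0 : g 0 = 0 := by simpa using hadd 0 0 le_rfl le_rfl
  have key : ∀ p q x : E, 0 ≤ p → 0 ≤ q → x = p - q → g x⁺ - g x⁻ = g p - g q := by
    intro p q x hp hq hx
    have h : p + x⁻ = x⁺ + q := by
      have := posPart_sub_negPart x
      rw [hx, sub_eq_sub_iff_add_eq_add, ← hx] at this
      exact this.symm
    have h' := congrArg g h
    rw [hadd _ _ hp (negPart_nonneg x), hadd _ _ (posPart_nonneg x) hq] at h'
    rw [sub_eq_sub_iff_add_eq_add, h']
  have hdec : ∀ x : E, x = x⁺ - x⁻ := fun x => (posPart_sub_negPart x).symm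
  refine ⟨{ toFun := fun x => g x⁺ - g x⁻, map_add' := fun x y => ?_,
            map_smul' := fun a x => ?_ }, fun x hx => ?_⟩
  · rw [key (x⁺ + y⁺) (x⁻ + y⁻) (x + y) (add_nonneg (posPart_nonneg x) (posPart_nonneg y))
      (add_nonneg (negPart_nonneg x) (negPart_nonneg y)) ?_,
      hadd _ _ (posPart_nonneg x) (posPart_nonneg y),
      hadd _ _ (negPart_nonneg x) (negPart_nonneg y)]
    · abel
    · conv_lhs => rw [hdec x, hdec y]
      abel
  · simp only [RingHom.id_apply]
    rcases lt_trichotomy a 0 with ha | rfl | ha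
    · have ha' := neg_pos.2 ha
      rw [key ((-a) • x⁻) ((-a) • x⁺) (a • x) (smul_nonneg ha'.le (negPart_nonneg x))
        (smul_nonneg ha'.le (posPart_nonneg x)) ?_,
        hsmul _ _ ha' (negPart_nonneg x), hsmul _ _ ha' (posPart_nonneg x)]
      · rw [← smul_sub, neg_smul, ← smul_neg, neg_sub]
      · conv_lhs => rw [hdec x]
        rw [← smul_sub, neg_smul, ← smul_neg, neg_sub]
    · simp [g0]
    · rw [key (a • x⁺) (a • x⁻) (a • x) (smul_nonneg ha.le (posPart_nonneg x))
        (smul_nonneg ha.le (negPart_nonneg x)) ?_,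
        hsmul _ _ ha (posPart_nonneg x), hsmul _ _ ha (negPart_nonneg x), smul_sub]
      rw [← smul_sub, ← hdec x]
  · show g x⁺ - g x⁻ = g x
    rw [key x 0 x hx le_rfl (by simp), g0, sub_zero]

end Extension

section Construction

variable {E F : Type*} [AddCommGroup E] [Module ℝ E] [Lattice E] [IsOrderedAddMonoid E]
  [PosSMulMono ℝ E] [AddCommGroup F] [Module ℝ F] [ConditionallyCompleteLattice F]
  [IsOrderedAddMonoid F] [PosSMulMono ℝ F]

/-- The operator `|T|` given by the Riesz–Kantorovich formula `|T| x = sup {T y | |y| ≤ x}`. -/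
theorem exists_modulus (T : E →ₗ[ℝ] F) (hT : ∀ x, BddAbove (T '' {y | |y| ≤ x})) :
    ∃ M : E →ₗ[ℝ] F, ∀ x, 0 ≤ x → IsLUB (T '' {y | |y| ≤ x}) (M x) := by
  have hne : ∀ x : E, 0 ≤ x → (T '' {y | |y| ≤ x}).Nonempty := fun x hx =>
    ⟨T 0, 0, by simpa using hx, rfl⟩
  have ⟨M, hM⟩ := exists_linearMap_eq_on_nonneg (fun x : E => sSup (T '' {y | |y| ≤ x})) ?_ ?_
  · refine ⟨M, fun x hx => ?_⟩
    rw [hM x hx]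
    exact isLUB_csSup (hne x hx) (hT x)
  · intro x y hx hy
    rw [← csSup_add (hne x hx) (hT x) (hne y hy) (hT y), ← Set.image_add]
    congr 2
    ext z
    simp only [Set.mem_ofPred_eq, Set.mem_add]
    constructor
    · intro hz
      exact ⟨_, abs_truncation_le z hx, _,
        (abs_sub_truncation_le hz (le_add_of_nonneg_right hy)).trans_eq (by abel), by abel⟩
    · rintro ⟨p, hp, q, hq, rfl⟩
      exact (abs_add_le p q).trans (add_le_add hp hq)
  · intro b z hb hz
    refine csSup_le (hne _ (smul_nonneg hb.le hz)) ?_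
    rintro _ ⟨y, hy, rfl⟩
    rw [← inv_smul_le_iff_of_pos hb, ← map_smul]
    refine le_csSup (hT z) ⟨_, ?_, rfl⟩
    refine (abs_smul_le _ _).trans ?_
    rw [abs_of_pos (inv_pos.2 hb)]
    exact (inv_smul_le_iff_of_pos hb).2 hy

/-- For a positive operator `T` and `u ≥ 0`, the operator `y ↦ sup_t T (y ⊓ t • u)`: the component
of `T` carried by the band generated by `u`. -/
theorem exists_component (T : E →ₗ[ℝ] F) (hT : ∀ x, 0 ≤ x → 0 ≤ T x) {u : E} (hu : 0 ≤ u) :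
    ∃ R : E →ₗ[ℝ] F, ∀ y, 0 ≤ y → IsLUB (T '' {z | ∃ t : ℝ, 0 ≤ t ∧ z = y ⊓ t • u}) (R y) := by
  have mono : ∀ {x y : E}, x ≤ y → T x ≤ T y := fun {x y} h => by
    simpa using hT _ (sub_nonneg.2 h)
  have hne : ∀ y : E, (T '' {z | ∃ t : ℝ, 0 ≤ t ∧ z = y ⊓ t • u}).Nonempty := fun y =>
    ⟨_, _, ⟨0, le_rfl, rfl⟩, rfl⟩
  have hbd : ∀ y : E, BddAbove (T '' {z | ∃ t : ℝ, 0 ≤ t ∧ z = y ⊓ t • u}) := fun y =>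
    ⟨T y, by rintro _ ⟨_, ⟨t, _, rfl⟩, rfl⟩; exact mono inf_le_left⟩
  have ⟨R, hR⟩ := exists_linearMap_eq_on_nonneg
    (fun y : E => sSup (T '' {z | ∃ t : ℝ, 0 ≤ t ∧ z = y ⊓ t • u})) ?_ ?_
  · refine ⟨R, fun y hy => ?_⟩
    rw [hR y hy]
    exact isLUB_csSup (hne y) (hbd y)
  · intro x y hx hy
    refine le_antisymm (csSup_le (hne _) ?_) ?_
    · rintro _ ⟨_, ⟨t, ht, rfl⟩, rfl⟩
      refine (mono (add_inf_le_inf_add_inf hx hy (smul_nonneg ht hu))).trans ?_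
      rw [map_add]
      exact add_le_add (le_csSup (hbd x) ⟨_, ⟨t, ht, rfl⟩, rfl⟩)
        (le_csSup (hbd y) ⟨_, ⟨t, ht, rfl⟩, rfl⟩)
    · rw [← csSup_add (hne x) (hbd x) (hne y) (hbd y)]
      refine csSup_le ((hne x).add (hne y)) ?_
      rintro _ ⟨_, ⟨_, ⟨t, ht, rfl⟩, rfl⟩, _, ⟨_, ⟨s, hs, rfl⟩, rfl⟩, rfl⟩
      dsimp only
      rw [← map_add]
      refine (mono (inf_add_inf_le_add_inf_add x y _ _)).trans ?_
      rw [← add_smul]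
      exact le_csSup (hbd _) ⟨_, ⟨_, add_nonneg ht hs, rfl⟩, rfl⟩
  · intro b z hb hz
    refine csSup_le (hne _) ?_
    rintro _ ⟨_, ⟨t, ht, rfl⟩, rfl⟩
    rw [← inv_smul_le_iff_of_pos hb, ← map_smul, smul_inf_of_pos (inv_pos.2 hb),
      inv_smul_smul₀ hb.ne', smul_smul]
    exact le_csSup (hbd z) ⟨_, ⟨_, mul_nonneg (inv_pos.2 hb).le ht, rfl⟩, rfl⟩

/-- A downward directed family of positive operators has a pointwise infimum on the cone. -/
theorem exists_directed_inf {ι : Type*} [Preorder ι] [IsDirectedOrder ι] [Nonempty ι]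
    (R : ι → E →ₗ[ℝ] F) (h0 : ∀ i x, 0 ≤ x → 0 ≤ R i x)
    (hR : ∀ i j x, i ≤ j → 0 ≤ x → R j x ≤ R i x) :
    ∃ S : E →ₗ[ℝ] F, ∀ x, 0 ≤ x → IsGLB (Set.range fun i => R i x) (S x) := by
  have hbd : ∀ x : E, 0 ≤ x → BddBelow (Set.range fun i => R i x) := fun x hx =>
    ⟨0, by rintro _ ⟨i, rfl⟩; exact h0 i x hx⟩
  have ⟨S, hS⟩ := exists_linearMap_eq_on_nonneg (fun x : E => ⨅ i, R i x) ?_ ?_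
  · refine ⟨S, fun x hx => ?_⟩
    rw [hS x hx]
    exact isGLB_ciInf (hbd x hx)
  · intro x y hx hy
    refine le_antisymm ?_ (le_ciInf fun i => ?_)
    · rw [← sub_le_iff_le_add]
      refine le_ciInf fun i => ?_
      rw [sub_le_comm]
      refine le_ciInf fun j => ?_
      obtain ⟨k, hik, hjk⟩ := exists_ge_ge i j
      rw [sub_le_iff_le_add]
      refine (ciInf_le (hbd _ (add_nonneg hx hy)) k).trans ?_
      rw [map_add, add_comm]
      exact add_le_add (hR _ _ _ hjk hy) (hR _ _ _ hik hx)
    · rw [map_add]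
      exact add_le_add (ciInf_le (hbd x hx) i) (ciInf_le (hbd y hy) i)
  · intro b z hb hz
    rw [← inv_smul_le_iff_of_pos hb]
    refine le_ciInf fun i => ?_
    rw [inv_smul_le_iff_of_pos hb, ← map_smul]
    exact ciInf_le (hbd _ (smul_nonneg hb.le hz)) i

end Construction

/-! ### Order null nets -/

/-- `x_α ↓ 0`: the net is decreasing with infimum `0`. -/
def DecreasesToZero {ι E : Type*} [Preorder ι] [Preorder E] [Zero E] (x : ι → E) : Prop :=
  Antitone x ∧ IsGLB (Set.range x) 0

theorem DecreasesToZero.nonneg {ι E : Type*} [Preorder ι] [Preorder E] [Zero E] {x : ι → E}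
    (hx : DecreasesToZero x) (i : ι) : 0 ≤ x i :=
  hx.2.1 ⟨i, rfl⟩

theorem DecreasesToZero.of_isLUB {ι E : Type*} [Preorder ι] [AddCommGroup E] [Lattice E]
    [IsOrderedAddMonoid E] {d : ι → E} {z : E} (hd : Monotone d) (hz : IsLUB (Set.range d) z) :
    DecreasesToZero fun i => z - d i := by
  refine ⟨fun i j hij => sub_le_sub_left (hd hij) z, ?_, fun b hb => ?_⟩
  · rintro _ ⟨i, rfl⟩
    exact sub_nonneg.2 (hz.1 ⟨i, rfl⟩)
  · have : z ≤ z - b := hz.2 (by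
      rintro _ ⟨i, rfl⟩
      exact le_sub_comm.1 (hb ⟨i, rfl⟩))
    simpa using this

/-- A net is order null if its absolute value is dominated by a net decreasing to `0`. -/
def OrderNull {ι E : Type*} [Preorder ι] [AddCommGroup E] [Lattice E] (x : ι → E) : Prop :=
  ∃ y : ι → E, (∀ i, |x i| ≤ y i) ∧ DecreasesToZero y

/-- A conditionally complete ordered vector space is Archimedean. -/
theorem nonpos_of_forall_le_smul {F : Type*} [AddCommGroup F] [Module ℝ F]
    [ConditionallyCompleteLattice F] [IsOrderedAddMonoid F] [PosSMulMono ℝ F] {f c : F}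
    (h : ∀ ε : ℝ, 0 < ε → f ≤ ε • c) : f ≤ 0 := by
  have hb : BddAbove (Set.range fun n : ℕ => ((n : ℝ) + 1) • f) := by
    refine ⟨c, ?_⟩
    rintro _ ⟨n, rfl⟩
    have hn : (0 : ℝ) < n + 1 := by positivity
    exact (le_inv_smul_iff_of_pos hn).1 (h _ (inv_pos.2 hn))
  -- The supremum `s` of the multiples `(n + 1) • f` satisfies `s ≤ s - f`.
  have hs : (⨆ n : ℕ, ((n : ℝ) + 1) • f) ≤ (⨆ n : ℕ, ((n : ℝ) + 1) • f) - f := by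
    refine ciSup_le fun n => ?_
    rw [le_sub_iff_add_le]
    refine le_trans (le_of_eq ?_) (le_ciSup hb (n + 1))
    push_cast
    module
  simpa using hs

/-! ### Order continuity of the modulus -/

section Operators

variable {E F : Type*} [AddCommGroup E] [Module ℝ E] [Lattice E] [IsOrderedAddMonoid E]
  [AddCommGroup F] [Module ℝ F] [Lattice F]

theorem modulus_nonneg {T M : E →ₗ[ℝ] F}
    (hM : ∀ x, 0 ≤ x → IsLUB (T '' {y | |y| ≤ x}) (M x)) {x : E} (hx : 0 ≤ x) : 0 ≤ M x := by
  have := (hM x hx).1 ⟨0, by simpa using hx, rfl⟩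
  simpa using this

theorem abs_map_le_modulus {T M : E →ₗ[ℝ] F}
    (hM : ∀ x, 0 ≤ x → IsLUB (T '' {y | |y| ≤ x}) (M x)) (x : E) : |T x| ≤ M |x| := by
  refine abs_le'.2 ⟨(hM _ (abs_nonneg x)).1 ⟨x, le_rfl, rfl⟩,
    (hM _ (abs_nonneg x)).1 ⟨-x, (abs_neg x).le, map_neg T x⟩⟩

variable [IsOrderedAddMonoid F]

theorem map_le_map_of_nonneg {A : E →ₗ[ℝ] F} (hA : ∀ x, 0 ≤ x → 0 ≤ A x) {x y : E} (h : x ≤ y) :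
    A x ≤ A y := by
  simpa using hA _ (sub_nonneg.2 h)

/-- The modulus of an order continuous operator maps nets decreasing to `0` to nets decreasing to
`0`.  For `|y| ≤ x = x_k`, truncating `y` at the levels `x_i` gives an order null net, and for
`i ≥ k` the truncation error is at most `x - x_i`; so `T y - T y_i ≤ |T| x - |T| x_i`, and
taking the supremum over `y` leaves no room for a positive lower bound of `|T| x_i`. -/
theorem decreasesToZero_modulus {ι : Type*} [Preorder ι] [IsDirectedOrder ι] [Nonempty ι]
    {T M : E →ₗ[ℝ] F} (hM : ∀ x, 0 ≤ x → IsLUB (T '' {y | |y| ≤ x}) (M x))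
    (hT : ∀ x : ι → E, OrderNull x → OrderNull fun i => T (x i)) {x : ι → E}
    (hx : DecreasesToZero x) : DecreasesToZero fun i => M (x i) := by
  have hM0 : ∀ x, 0 ≤ x → 0 ≤ M x := fun x => modulus_nonneg hM
  refine ⟨fun i j hij => map_le_map_of_nonneg hM0 (hx.1 hij), ?_, fun f hf => ?_⟩
  · rintro _ ⟨i, rfl⟩
    exact hM0 _ (hx.nonneg i)
  obtain ⟨k⟩ := ‹Nonempty ι›
  suffices h : M (x k) ≤ M (x k) - f by simpa using h
  refine (hM _ (hx.nonneg k)).2 ?_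
  rintro _ ⟨y, hy, rfl⟩
  obtain ⟨w, hw, hw0⟩ := hT (fun i => (y ⊓ x i) ⊔ -x i)
    ⟨x, fun i => abs_truncation_le y (hx.nonneg i), hx⟩
  have key : f - (M (x k) - T y) ≤ 0 := hw0.2.2 (by
    rintro _ ⟨j, rfl⟩
    obtain ⟨i, hki, hji⟩ := exists_ge_ge k j
    refine le_trans ?_ (hw0.1 hji)
    have h₁ : T (y - ((y ⊓ x i) ⊔ -x i)) ≤ M (x k - x i) :=
      (hM _ (sub_nonneg.2 (hx.1 hki))).1 ⟨_, abs_sub_truncation_le hy (hx.1 hki), rfl⟩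
    have h₂ : T ((y ⊓ x i) ⊔ -x i) ≤ w i := (le_abs_self _).trans (hw i)
    have h₃ : f ≤ M (x i) := hf ⟨i, rfl⟩
    rw [map_sub, map_sub] at h₁
    have := add_le_add (add_le_add h₁ h₂) h₃
    have e : f - (M (x k) - T y) = T y - T ((y ⊓ x i) ⊔ -x i) + T ((y ⊓ x i) ⊔ -x i) + f
        - M (x k) := by abel
    rw [e, sub_le_iff_le_add]
    refine this.trans (le_of_eq ?_)
    abel)
  rw [sub_nonpos] at key
  exact le_sub_comm.1 key

theorem orderNull_of_modulus {ι : Type*} [Preorder ι] {T M : E →ₗ[ℝ] F}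
    (hM : ∀ x, 0 ≤ x → IsLUB (T '' {y | |y| ≤ x}) (M x))
    (h : ∀ x : ι → E, DecreasesToZero x → DecreasesToZero fun i => M (x i)) {x : ι → E}
    (hx : OrderNull x) : OrderNull fun i => T (x i) := by
  obtain ⟨y, hy, hy0⟩ := hx
  exact ⟨_, fun i => (abs_map_le_modulus hM (x i)).trans
    (map_le_map_of_nonneg (fun x => modulus_nonneg hM) (hy i)), h y hy0⟩

theorem DecreasesToZero.map_of_le_smul [PosSMulMono ℝ F] {ι : Type*} [Preorder ι]
    {A M : E →ₗ[ℝ] F} {c : ℝ} (hc : 0 < c) (hA : ∀ x, 0 ≤ x → 0 ≤ A x)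
    (hAM : ∀ x, 0 ≤ x → A x ≤ c • M x) {x : ι → E} (hx : DecreasesToZero x)
    (hMx : DecreasesToZero fun i => M (x i)) : DecreasesToZero fun i => A (x i) := by
  refine ⟨fun i j hij => map_le_map_of_nonneg hA (hx.1 hij), ?_, fun f hf => ?_⟩
  · rintro _ ⟨i, rfl⟩
    exact hA _ (hx.nonneg i)
  · have : c⁻¹ • f ≤ 0 := hMx.2.2 (by
      rintro _ ⟨i, rfl⟩
      exact (inv_smul_le_iff_of_pos hc).2 ((hf ⟨i, rfl⟩).trans (hAM _ (hx.nonneg i))))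
    simpa using (inv_smul_le_iff_of_pos hc).1 this

/-- The kernel of `x ↦ A |x|`, for `A` positive and order continuous, contains the limits of its
increasing nets: if `A d_i = 0` for all `i` then `A (z - d_i) = A z` does not depend on `i`. -/
theorem map_abs_eq_zero_of_isLUB {ι : Type*} [Preorder ι] [Nonempty ι] {A : E →ₗ[ℝ] F}
    (hA : ∀ x, 0 ≤ x → 0 ≤ A x)
    (hcont : ∀ x : ι → E, DecreasesToZero x → DecreasesToZero fun i => A (x i))
    {d : ι → E} {z : E} (hd : Monotone d) (hz : IsLUB (Set.range d) z)
    (h0 : ∀ i, A |d i| = 0) : A |z| = 0 := by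
  have hd0 : ∀ i, A (d i) = 0 := fun i => by
    refine le_antisymm ((map_le_map_of_nonneg hA (le_abs_self _)).trans_eq (h0 i)) ?_
    have := map_le_map_of_nonneg hA (neg_le.1 (neg_le_abs (d i)))
    rwa [map_neg, h0 i, neg_zero] at this
  have hle : A z ≤ 0 := (hcont _ (DecreasesToZero.of_isLUB hd hz)).2.2 (by
    rintro _ ⟨i, rfl⟩
    simp [hd0 i])
  obtain ⟨k⟩ := ‹Nonempty ι›
  refine le_antisymm ?_ (hA _ (abs_nonneg z))
  calc A |z| ≤ A ((z - d k) + |d k|) := map_le_map_of_nonneg hA (by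
        have := abs_add_le (z - d k) (d k)
        rwa [sub_add_cancel, abs_of_nonneg (sub_nonneg.2 (hz.1 ⟨k, rfl⟩))] at this)
    _ ≤ 0 := by simpa [h0 k, hd0 k] using hle

end Operators

/-! ### Order continuity from the kernels of smaller operators -/

section Converse

variable {E F : Type*} [AddCommGroup E] [Module ℝ E] [Lattice E] [IsOrderedAddMonoid E]
  [PosSMulMono ℝ E] [AddCommGroup F] [Module ℝ F] [ConditionallyCompleteLattice F]
  [IsOrderedAddMonoid F] [PosSMulMono ℝ F]

/-- A positive operator `T` maps nets decreasing to `0` to nets decreasing to `0` as soon as the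
kernel of every positive `S ≤ T` is closed under suprema of increasing positive nets.  The
hypothesis is applied to one `S` for each `ε > 0`, built from the components of `T` carried by
`(y_i - ε • y_k)⁺`. -/
theorem decreasesToZero_map_of_kernels {ι : Type*} [Preorder ι] [IsDirectedOrder ι] [Nonempty ι]
    {T : E →ₗ[ℝ] F} (hT : ∀ x, 0 ≤ x → 0 ≤ T x)
    (hker : ∀ S : E →ₗ[ℝ] F, (∀ x, 0 ≤ x → 0 ≤ S x) → (∀ x, 0 ≤ x → S x ≤ T x) →
      ∀ (d : ι → E) (z : E), Monotone d → IsLUB (Set.range d) z →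
        (∀ i, 0 ≤ d i ∧ S (d i) = 0) → S z = 0)
    {y : ι → E} (hy : DecreasesToZero y) : DecreasesToZero fun i => T (y i) := by
  have mono : ∀ {x y : E}, x ≤ y → T x ≤ T y := fun h => map_le_map_of_nonneg hT h
  refine ⟨fun i j hij => mono (hy.1 hij), ?_, fun f hf => ?_⟩
  · rintro _ ⟨i, rfl⟩
    exact hT _ (hy.nonneg i)
  obtain ⟨k⟩ := id ‹Nonempty ι›
  refine nonpos_of_forall_le_smul (c := T (y k)) fun ε hε => ?_
  have hx : 0 ≤ ε • y k := smul_nonneg hε.le (hy.nonneg k)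
  -- `S` is the infimum of the components `R i` of `T` carried by `(y i - ε • y k)⁺`.
  choose R hR using fun i => exists_component T hT (posPart_nonneg (y i - ε • y k))
  have hR0 : ∀ i x, 0 ≤ x → 0 ≤ R i x := fun i x h =>
    (hT _ (le_inf h (smul_nonneg zero_le_one (posPart_nonneg _)))).trans
      ((hR i x h).1 ⟨_, ⟨1, zero_le_one, rfl⟩, rfl⟩)
  have hRT : ∀ i x, 0 ≤ x → R i x ≤ T x := fun i x h => (hR i x h).2 (by
    rintro _ ⟨_, ⟨t, ht, rfl⟩, rfl⟩
    exact mono inf_le_left)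
  have hRanti : ∀ i j x, i ≤ j → 0 ≤ x → R j x ≤ R i x := fun i j x hij h => (hR j x h).2 (by
    rintro _ ⟨_, ⟨t, ht, rfl⟩, rfl⟩
    refine (mono (inf_le_inf_left x (smul_le_smul_of_nonneg_left ?_ ht))).trans
      ((hR i x h).1 ⟨_, ⟨t, ht, rfl⟩, rfl⟩)
    exact posPart_mono (sub_le_sub_right (hy.1 hij) _))
  obtain ⟨S, hS⟩ := exists_directed_inf R hR0 hRanti
  have hS0 : ∀ x, 0 ≤ x → 0 ≤ S x := fun x h => (hS x h).2 (by
    rintro _ ⟨i, rfl⟩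
    exact hR0 i x h)
  -- `S` vanishes on `(ε • y k - y i)⁺`, a net increasing to `ε • y k`.
  have hSx : S (ε • y k) = 0 := by
    refine hker S hS0 (fun x h => ((hS x h).1 ⟨k, rfl⟩).trans (hRT k x h))
      (fun i => (ε • y k - y i)⁺) _ ?_ ⟨?_, fun b hb => ?_⟩ fun i => ⟨posPart_nonneg _, ?_⟩
    · exact fun i j hij => posPart_mono (sub_le_sub_left (hy.1 hij) _)
    · rintro _ ⟨i, rfl⟩
      exact sup_le (sub_le_self _ (hy.nonneg i)) hx
    · have : ε • y k - b ≤ 0 := hy.2.2 (by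
        rintro _ ⟨i, rfl⟩
        have : ε • y k - y i ≤ b := le_sup_left.trans (hb ⟨i, rfl⟩)
        exact sub_le_comm.1 this)
      exact sub_nonpos.1 this
    · have hpos := posPart_nonneg (ε • y k - y i)
      refine le_antisymm (((hS _ hpos).1 ⟨i, rfl⟩).trans ((hR i _ hpos).2 ?_)) (hS0 _ hpos)
      rintro _ ⟨_, ⟨t, ht, rfl⟩, rfl⟩
      rw [inf_smul_eq_zero (posPart_nonneg _) hpos ?_ ht, map_zero]
      have := posPart_inf_negPart_eq_zero (y i - ε • y k)
      rwa [← posPart_neg, neg_sub] at this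
  rw [map_smul] at hSx
  have hSk : S (y k) = 0 := (smul_eq_zero_iff_right hε.ne').1 hSx
  suffices h : f - ε • T (y k) ≤ S (y k) by
    rwa [hSk, sub_nonpos] at h
  refine (hS _ (hy.nonneg k)).2 ?_
  rintro _ ⟨j, rfl⟩
  obtain ⟨i, hki, hji⟩ := exists_ge_ge k j
  refine le_trans ?_ (hRanti j i _ hji (hy.nonneg k))
  -- For `i ≥ k` the element `(y i - ε • y k)⁺` is below `y k`, so `R i (y k)` is at least its
  -- image under `T`.
  have hle : (y i - ε • y k)⁺ ≤ y k :=
    sup_le ((sub_le_self _ hx).trans (hy.1 hki)) (hy.nonneg k)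
  have h₁ : T (y i - ε • y k)⁺ ≤ R i (y k) :=
    (hR i _ (hy.nonneg k)).1 ⟨_, ⟨1, zero_le_one, by rw [one_smul, inf_eq_right.2 hle]⟩, rfl⟩
  refine le_trans ?_ h₁
  have h₂ : f ≤ T (y i) := hf ⟨i, rfl⟩
  refine le_trans (sub_le_sub_right h₂ _) ?_
  rw [← map_smul, ← map_sub]
  exact mono (le_posPart _)

end Converse

end RieszOperator

namespace FuzzyRiesz

open RieszOperator

/-! ### Fuzzy Riesz spaces as vector lattices -/

section Space

variable {E : Type*} [AddCommGroup E] [Module ℝ E] [FuzzyRieszSpace E]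

/-- The lattice whose order is `FLE`; its supremum operation is `fsup`. -/
noncomputable instance instLattice : Lattice E where
  le := FLE
  le_refl := FLE.refl
  le_trans _ _ _ := FLE.trans
  le_antisymm _ _ := FLE.antisymm
  sup := fsup
  inf x y := (FuzzyRieszSpace.exists_inf x y).choose
  le_sup_left x y := (isFSup_iff.1 (fsup_spec x y)).1 x (by simp)
  le_sup_right x y := (isFSup_iff.1 (fsup_spec x y)).1 y (by simp)
  sup_le x y z hx hy := (isFSup_iff.1 (fsup_spec x y)).2 z (by simp [hx, hy])
  inf_le_left x y := (isFInf_iff.1 (FuzzyRieszSpace.exists_inf x y).choose_spec).1 x (by simp)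
  inf_le_right x y := (isFInf_iff.1 (FuzzyRieszSpace.exists_inf x y).choose_spec).1 y (by simp)
  le_inf z x y hx hy :=
    (isFInf_iff.1 (FuzzyRieszSpace.exists_inf x y).choose_spec).2 z (by simp [hx, hy])

instance instIsOrderedAddMonoid : IsOrderedAddMonoid E where
  add_le_add_left _ _ h z := FLE.add_right h z

instance instPosSMulMono : PosSMulMono ℝ E where
  smul_le_smul_of_nonneg_left a ha x y h := by
    rcases ha.eq_or_lt with rfl | ha
    · simp
    · exact FLE.smul h ha

theorem fle_iff_le {x y : E} : FLE x y ↔ x ≤ y := Iff.rfl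

theorem fabs_eq_abs (x : E) : fabs x = |x| := rfl

theorem isFSup_iff_isLUB {A : Set E} {z : E} : IsFSup A z ↔ IsLUB A z := isFSup_iff

theorem isFInf_iff_isGLB {A : Set E} {z : E} : IsFInf A z ↔ IsGLB A z := isFInf_iff

theorem decreasesTo_zero_iff {ι : Type*} [Preorder ι] {y : ι → E} :
    DecreasesTo y 0 ↔ DecreasesToZero y :=
  and_congr ⟨fun h _ _ hij => h _ _ hij, fun h _ _ hij => h hij⟩ isFInf_iff_isGLB

theorem increasesTo_iff {x : ℕ → E} {l : E} :
    IncreasesTo x l ↔ Monotone x ∧ IsLUB (Set.range x) l :=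
  and_congr ⟨fun h _ _ hij => h _ _ hij, fun h _ _ hij => h hij⟩ isFSup_iff_isLUB

theorem orderConverges_zero_iff {ι : Type*} [Preorder ι] {x : ι → E} :
    OrderConverges x 0 ↔ OrderNull x := by
  simp only [OrderConverges, OrderNull, sub_zero, decreasesTo_zero_iff, fle_iff_le, fabs_eq_abs]

theorem fBounded_iff {C : Set E} : FBounded C ↔ BddAbove C ∧ BddBelow C := by
  simp only [FBounded, isUpper_iff, isLower_iff]
  rfl

open Classical in
/-- A fuzzy Dedekind complete space as a conditionally complete lattice. -/
noncomputable abbrev conditionallyCompleteLattice (hE : FuzzyDedekindComplete E) :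
    ConditionallyCompleteLattice E :=
  letI : SupSet E := ⟨fun s =>
    if h : s.Nonempty ∧ ∃ y, IsUpper s y then (hE s h.1 h.2).choose else 0⟩
  conditionallyCompleteLatticeOfLatticeOfsSup E fun s hb hn => by
    have h : s.Nonempty ∧ ∃ y, IsUpper s y := ⟨hn, hb.imp fun y hy => isUpper_iff.2 hy⟩
    have := (hE s h.1 h.2).choose_spec
    rw [isFSup_iff_isLUB] at this
    show IsLUB s (dite _ _ _)
    rwa [dif_pos h]

end Space

/-! ### The modulus in `FL_b(E,F)`, null ideals and generated ideals -/

section Operators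

variable {E : Type u} {F : Type v} [AddCommGroup E] [Module ℝ E] [FuzzyRieszSpace E]
  [AddCommGroup F] [Module ℝ F] [FuzzyRieszSpace F]

theorem fuzzyPositive_iff {T : E →ₗ[ℝ] F} : FuzzyPositive T ↔ ∀ x, 0 ≤ x → 0 ≤ T x := Iff.rfl

theorem FuzzyPositive.fuzzyOrderBounded {T : E →ₗ[ℝ] F} (hT : FuzzyPositive T) :
    FuzzyOrderBounded T := by
  intro C hC
  rw [fBounded_iff] at hC ⊢
  have mono : Monotone T := fun x y h => map_le_map_of_nonneg (fuzzyPositive_iff.1 hT) h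
  exact ⟨mono.map_bddAbove hC.1, mono.map_bddBelow hC.2⟩

theorem FuzzyOrderBounded.bddAbove_image {T : E →ₗ[ℝ] F} (hT : FuzzyOrderBounded T) (x : E) :
    BddAbove (T '' {y | |y| ≤ x}) :=
  (fBounded_iff.1 (hT _ (fBounded_iff.2 ⟨⟨x, fun y hy => (le_abs_self y).trans hy⟩,
    ⟨-x, fun y hy => neg_le.1 ((neg_le_abs y).trans hy)⟩⟩))).1

theorem fle_FLb_iff_forall {S T : FLb E F} :
    FLE S T ↔ ∀ x : E, 0 ≤ x → (S : E →ₗ[ℝ] F) x ≤ (T : E →ₗ[ℝ] F) x := by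
  rw [fle_FLb_iff]
  exact forall₂_congr fun x _ => (sub_nonneg (a := (T : E →ₗ[ℝ] F) x))

theorem isFAbs_FLb_iff {S A : FLb E F} :
    IsFAbs S A ↔ (FLE S A ∧ FLE (-S) A) ∧ ∀ B, FLE S B → FLE (-S) B → FLE A B := by
  simp [IsFAbs, isFSup_iff]

/-- An operator given by the Riesz–Kantorovich formula is the modulus in `FL_b(E,F)`. -/
theorem isFAbs_of_isLUB {S A : FLb E F}
    (h : ∀ x : E, 0 ≤ x → IsLUB ((S : E →ₗ[ℝ] F) '' {y | |y| ≤ x}) ((A : E →ₗ[ℝ] F) x)) :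
    IsFAbs S A := by
  rw [isFAbs_FLb_iff]
  simp only [fle_FLb_iff_forall, NegMemClass.coe_neg, LinearMap.neg_apply]
  refine ⟨⟨fun x hx => (h x hx).1 ⟨x, (abs_of_nonneg hx).le, rfl⟩,
    fun x hx => (h x hx).1 ⟨-x, ?_, map_neg _ x⟩⟩, fun B h₁ h₂ x hx => (h x hx).2 ?_⟩
  · rw [Set.mem_ofPred_eq, abs_neg, abs_of_nonneg hx]
  · rintro _ ⟨y, hy, rfl⟩
    have hB : ∀ x : E, 0 ≤ x → 0 ≤ (B : E →ₗ[ℝ] F) x := fun x hx =>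
      (abs_nonneg _).trans (abs_le'.2 ⟨h₁ x hx, h₂ x hx⟩)
    refine le_trans ?_ (map_le_map_of_nonneg hB hy)
    have := add_le_add (h₁ _ (posPart_nonneg y)) (h₂ _ (negPart_nonneg y))
    rwa [← map_neg, ← map_add, ← map_add, ← sub_eq_add_neg, posPart_sub_negPart,
      posPart_add_negPart] at this

/-- The modulus in `FL_b(E,F)` exists and is given by the Riesz–Kantorovich formula. -/
theorem exists_isFAbs (hF : FuzzyDedekindComplete F) (S : FLb E F) :
    ∃ A : FLb E F, IsFAbs S A ∧
      ∀ x : E, 0 ≤ x → IsLUB ((S : E →ₗ[ℝ] F) '' {y | |y| ≤ x}) ((A : E →ₗ[ℝ] F) x) := by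
  let _ := conditionallyCompleteLattice hF
  obtain ⟨M, hM⟩ := exists_modulus (S : E →ₗ[ℝ] F) (FuzzyOrderBounded.bddAbove_image S.2)
  have hM0 : FuzzyPositive M := fun x hx => modulus_nonneg hM hx
  exact ⟨⟨M, hM0.fuzzyOrderBounded⟩, isFAbs_of_isLUB hM, hM⟩

theorem isFAbs_self {S : FLb E F} (hS : FuzzyPositive (S : E →ₗ[ℝ] F)) : IsFAbs S S := by
  rw [isFAbs_FLb_iff]
  refine ⟨⟨FLE.refl S, fle_FLb_iff_forall.2 fun x hx => ?_⟩, fun B h _ => h⟩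
  have : 0 ≤ (S : E →ₗ[ℝ] F) x := hS x hx
  exact (neg_nonpos.2 this).trans this

theorem nullIdeal_eq {S A : FLb E F} (h : IsFAbs S A) :
    nullIdeal S = {x : E | (A : E →ₗ[ℝ] F) |x| = 0} := by
  ext x
  constructor
  · rintro ⟨B, hB, hx⟩
    rwa [IsFSup.unique hB h] at hx
  · exact fun hx => ⟨A, h, hx⟩

theorem isFuzzyIdeal_setOf_map_abs_eq_zero {A : E →ₗ[ℝ] F} (hA : FuzzyPositive A) :
    IsFuzzyIdeal {x : E | A |x| = 0} := by
  have hA' := fuzzyPositive_iff.1 hA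
  have zero_of_le : ∀ x b : E, |x| ≤ b → A b = 0 → A |x| = 0 := fun x b h hb =>
    le_antisymm ((map_le_map_of_nonneg hA' h).trans_eq hb) (hA' _ (abs_nonneg x))
  refine ⟨⟨{ carrier := {x : E | A |x| = 0}, add_mem' := fun {x y} hx hy => ?_,
             zero_mem' := ?_, smul_mem' := fun a x hx => ?_ }, rfl⟩, ?_⟩
  · exact zero_of_le _ _ (abs_add_le x y) (by
      rw [map_add, show A |x| = 0 from hx, show A |y| = 0 from hy, add_zero])
  · simp
  · exact zero_of_le _ _ (abs_smul_le a x) (by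
      rw [map_smul, show A |x| = 0 from hx, smul_zero])
  · intro x y a b hx hy hab hyA
    rw [isFAbs_iff] at hx hy
    subst hx hy
    exact zero_of_le x _ hab hyA

/-- The operators dominated by a multiple of the positive operator `M`. -/
def dominated (M : FLb E F) (hM : FuzzyPositive (M : E →ₗ[ℝ] F)) : Submodule ℝ (FLb E F) where
  carrier := {S | ∃ c : ℝ, 0 < c ∧ FLE S (c • M) ∧ FLE (-S) (c • M)}
  add_mem' := by
    rintro S S' ⟨c, hc, h₁, h₂⟩ ⟨c', hc', h₁', h₂'⟩
    refine ⟨c + c', add_pos hc hc', ?_, ?_⟩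
    · rw [add_smul]
      exact h₁.add h₁'
    · rw [add_smul, neg_add]
      exact h₂.add h₂'
  zero_mem' := by
    have : FLE 0 ((1 : ℝ) • M) := fle_FLb_iff_forall.2 fun x hx => by
      rw [one_smul]
      exact hM x hx
    exact ⟨1, one_pos, this, by simpa using this⟩
  smul_mem' := by
    rintro a S ⟨c, hc, h₁, h₂⟩
    rcases lt_trichotomy a 0 with ha | rfl | ha
    · refine ⟨-a * c, mul_pos (neg_pos.2 ha) hc, ?_, ?_⟩
      · have := h₂.smul (neg_pos.2 ha)
        rwa [neg_smul_neg, ← mul_smul] at this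
      · rw [← neg_smul, mul_smul]
        exact h₁.smul (neg_pos.2 ha)
    · have : FLE 0 ((1 : ℝ) • M) := fle_FLb_iff_forall.2 fun x hx => by
        rw [one_smul]
        exact hM x hx
      exact ⟨1, one_pos, by simpa using this, by simpa using this⟩
    · refine ⟨a * c, mul_pos ha hc, ?_, ?_⟩
      · simpa [mul_smul] using h₁.smul ha
      · simpa [mul_smul] using h₂.smul ha

theorem isFuzzyIdeal_dominated {M : FLb E F} (hM : FuzzyPositive (M : E →ₗ[ℝ] F)) :
    IsFuzzyIdeal (dominated M hM : Set (FLb E F)) := by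
  refine ⟨⟨_, rfl⟩, ?_⟩
  rintro S S' A A' hS hS' hAA ⟨c, hc, h₁, h₂⟩
  rw [isFAbs_FLb_iff] at hS hS'
  have h := hAA.trans (hS'.2 _ h₁ h₂)
  exact ⟨c, hc, hS.1.1.trans h, hS.1.2.trans h⟩

theorem mem_idealGenerated_of_le {T M S : FLb E F} (hM : IsFAbs T M)
    (hS : FuzzyPositive (S : E →ₗ[ℝ] F)) (hSM : FLE S M) : S ∈ idealGenerated {T} :=
  (idealGenerated_isLeast {T}).1.1.2 S T S M (isFAbs_self hS) hM hSM
    ((idealGenerated_isLeast {T}).1.2 rfl)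

theorem exists_le_smul_of_mem_idealGenerated {T M S A : FLb E F} (hM : IsFAbs T M)
    (hM0 : FuzzyPositive (M : E →ₗ[ℝ] F)) (hS : S ∈ idealGenerated {T}) (hA : IsFAbs S A) :
    ∃ c : ℝ, 0 < c ∧ FLE A (c • M) := by
  have hT : T ∈ dominated M hM0 := by
    have := (isFAbs_FLb_iff.1 hM).1
    exact ⟨1, one_pos, by simpa using this.1, by simpa using this.2⟩
  obtain ⟨c, hc, h₁, h₂⟩ := (idealGenerated_isLeast {T}).2
    ⟨isFuzzyIdeal_dominated hM0, Set.singleton_subset_iff.2 hT⟩ hS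
  exact ⟨c, hc, (isFAbs_FLb_iff.1 hA).2 _ h₁ h₂⟩

theorem isFuzzyIdeal_nullIdeal (hF : FuzzyDedekindComplete F) (S : FLb E F) :
    IsFuzzyIdeal (nullIdeal S : Set E) := by
  obtain ⟨A, hA, hA'⟩ := exists_isFAbs hF S
  rw [nullIdeal_eq hA]
  exact isFuzzyIdeal_setOf_map_abs_eq_zero fun x hx => modulus_nonneg hA' hx

/-- If `T` is order continuous along nets indexed by `ι`, then `N_S` contains the suprema of its
increasing nets indexed by `ι`. -/
theorem mem_nullIdeal_of_isLUB (hF : FuzzyDedekindComplete F) {ι : Type*} [Preorder ι]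
    [IsDirectedOrder ι] [Nonempty ι] {T S : FLb E F}
    (hT : ∀ x : ι → E, OrderNull x → OrderNull fun i => (T : E →ₗ[ℝ] F) (x i))
    (hS : S ∈ idealGenerated {T}) {d : ι → E} {z : E} (hd : Monotone d)
    (hz : IsLUB (Set.range d) z) (h0 : ∀ i, d i ∈ nullIdeal S) : z ∈ nullIdeal S := by
  obtain ⟨M, hM, hM'⟩ := exists_isFAbs hF T
  obtain ⟨A, hA, hA'⟩ := exists_isFAbs hF S
  obtain ⟨c, hc, hAM⟩ := exists_le_smul_of_mem_idealGenerated hM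
    (fun x hx => modulus_nonneg hM' hx) hS hA
  rw [nullIdeal_eq hA] at h0 ⊢
  have hA0 : ∀ x : E, 0 ≤ x → 0 ≤ (A : E →ₗ[ℝ] F) x := fun x => modulus_nonneg hA'
  exact map_abs_eq_zero_of_isLUB hA0 (fun x hx => hx.map_of_le_smul hc hA0
    (fle_FLb_iff_forall.1 hAM) (decreasesToZero_modulus hM' hT hx)) hd hz h0

/-- If the null ideals `N_S` contain the suprema of their increasing positive nets indexed by `ι`,
then `T` is order continuous along nets indexed by `ι`. -/
theorem orderNull_map_of_nullIdeals (hF : FuzzyDedekindComplete F) {ι : Type*} [Preorder ι]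
    [IsDirectedOrder ι] [Nonempty ι] {T : FLb E F}
    (h : ∀ S ∈ idealGenerated {T}, ∀ (d : ι → E) (z : E), Monotone d → IsLUB (Set.range d) z →
      (∀ i, d i ∈ nullIdeal S ∧ 0 ≤ d i) → z ∈ nullIdeal S)
    {x : ι → E} (hx : OrderNull x) : OrderNull fun i => (T : E →ₗ[ℝ] F) (x i) := by
  obtain ⟨M, hM, hM'⟩ := exists_isFAbs hF T
  let _ := conditionallyCompleteLattice hF
  refine orderNull_of_modulus hM' (fun y hy => ?_) hx
  refine decreasesToZero_map_of_kernels (fun x => modulus_nonneg hM') ?_ hy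
  intro S hS hSM d z hd hz hd0
  have hS' : FuzzyPositive S := hS
  let S' : FLb E F := ⟨S, hS'.fuzzyOrderBounded⟩
  have hSS : IsFAbs S' S' := isFAbs_self hS'
  have hmem := h S' (mem_idealGenerated_of_le hM hS' (fle_FLb_iff_forall.2 hSM)) d z hd hz
  rw [nullIdeal_eq hSS] at hmem
  obtain ⟨i⟩ := ‹Nonempty ι›
  have := hmem fun i => ⟨by
    show S |d i| = 0
    rw [abs_of_nonneg (hd0 i).1, (hd0 i).2], (hd0 i).1⟩
  rwa [Set.mem_ofPred_eq, abs_of_nonneg ((hd0 i).1.trans (hz.1 ⟨i, rfl⟩))] at this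

end Operators

/-! ### Null ideals as bands -/

/-- If `T` is order continuous, then `N_S` is a band: the supremum `z` of `D ⊆ N_S` is also the
supremum of the upward directed set of all `d ∈ N_S` with `d ≤ z`, taken as a net. -/
theorem isFuzzyBand_nullIdeal {E : Type u} {F : Type v}
    [AddCommGroup E] [Module ℝ E] [FuzzyRieszSpace E]
    [AddCommGroup F] [Module ℝ F] [FuzzyRieszSpace F]
    (hF : FuzzyDedekindComplete F) {T S : FLb E F}
    (hT : FuzzyOrderContinuous.{u, v, max u w} (T : E →ₗ[ℝ] F)) (hS : S ∈ idealGenerated {T}) :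
    IsFuzzyBand (nullIdeal S : Set E) := by
  have hideal := isFuzzyIdeal_nullIdeal hF S
  refine ⟨hideal, fun D z hD hz => ?_⟩
  rw [isFSup_iff_isLUB] at hz
  obtain ⟨⟨K, hK⟩, hsolid⟩ := hideal
  have solid : ∀ x y : E, |x| ≤ |y| → y ∈ nullIdeal S → x ∈ nullIdeal S := fun x y =>
    hsolid x y _ _ (isFAbs_iff.2 rfl) (isFAbs_iff.2 rfl)
  have habs : ∀ x ∈ nullIdeal S, |x| ∈ nullIdeal S := fun x hx =>
    solid _ _ (abs_abs x).le hx
  rcases D.eq_empty_or_nonempty with rfl | ⟨d₀, hd₀⟩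
  · -- The supremum of the empty set is a least element, which in a group can only be `0`.
    have hbot : ∀ y, z ≤ y := fun y => hz.2 (by simp)
    have : z = 0 := le_antisymm (hbot 0) (by simpa using hbot (z + z))
    rw [this, ← hK]
    exact K.zero_mem
  -- The lift moves the index set into the universe in which order continuity is tested.
  let ι := ULift.{w} {d : E // d ∈ nullIdeal S ∧ d ≤ z}
  have : Nonempty ι := ⟨⟨d₀, hD hd₀, hz.1 hd₀⟩⟩
  have : IsDirectedOrder ι := ⟨by
    rintro ⟨a, ha, haz⟩ ⟨b, hb, hbz⟩
    refine ⟨⟨a ⊔ b, ?_, sup_le haz hbz⟩, le_sup_left (a := a), le_sup_right (a := a)⟩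
    refine solid _ (|a| + |b|) ?_ ?_
    · rw [abs_of_nonneg (add_nonneg (abs_nonneg a) (abs_nonneg b))]
      refine abs_le'.2 ⟨sup_le ?_ ?_, ?_⟩
      · exact (le_abs_self a).trans (le_add_of_nonneg_right (abs_nonneg b))
      · exact (le_abs_self b).trans (le_add_of_nonneg_left (abs_nonneg a))
      · rw [neg_sup]
        exact inf_le_left.trans
          ((neg_le_abs a).trans (le_add_of_nonneg_right (abs_nonneg b)))
    · rw [← hK]
      have h₁ := habs a ha
      have h₂ := habs b hb
      rw [← hK] at h₁ h₂
      exact K.add_mem h₁ h₂⟩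
  refine mem_nullIdeal_of_isLUB hF (ι := ι) (d := fun i => i.down.1) (fun x hx => ?_) hS
    (fun i j h => h) ⟨?_, fun b hb => hz.2 fun d hd => ?_⟩ fun i => i.down.2.1
  · exact orderConverges_zero_iff.1 (hT ι x (orderConverges_zero_iff.2 hx))
  · rintro _ ⟨i, rfl⟩
    exact i.down.2.2
  · exact hb ⟨⟨d, hD hd, hz.1 hd⟩, rfl⟩

end FuzzyRiesz

open FuzzyRiesz RieszOperator

theorem theorem4p7 {E : Type u} {F : Type v}
    [AddCommGroup E] [Module ℝ E] [FuzzyRiesz.FuzzyRieszSpace E]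
    [AddCommGroup F] [Module ℝ F] [FuzzyRiesz.FuzzyRieszSpace F]
    (hF : FuzzyRiesz.FuzzyDedekindComplete F)
    (T : E →ₗ[ℝ] F) (hT : FuzzyRiesz.FuzzyOrderBounded T) :
    (FuzzyRiesz.FuzzyOrderContinuous.{u, v, max u w} T ↔
      ∀ S ∈ FuzzyRiesz.idealGenerated {(⟨T, hT⟩ : FuzzyRiesz.FLb E F)},
        FuzzyRiesz.IsFuzzyBand (FuzzyRiesz.nullIdeal S)) ∧
    (FuzzyRiesz.FuzzySigmaOrderContinuous T ↔
      ∀ S ∈ FuzzyRiesz.idealGenerated {(⟨T, hT⟩ : FuzzyRiesz.FLb E F)},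
        FuzzyRiesz.IsFuzzySigmaIdeal (FuzzyRiesz.nullIdeal S)) := by
  refine ⟨⟨fun h S hS => isFuzzyBand_nullIdeal.{u, v, w} hF (T := ⟨T, hT⟩) h hS, fun h ι _ _ _ x hx => ?_⟩,
    ⟨fun h S hS => ⟨isFuzzyIdeal_nullIdeal hF S, fun x l hx hl => ?_⟩, fun h x hx => ?_⟩⟩
  · rw [orderConverges_zero_iff] at hx ⊢
    exact orderNull_map_of_nullIdeals hF (T := ⟨T, hT⟩) (fun S hS d z _ hz hd =>
      (h S hS).2 _ z (by rintro _ ⟨i, rfl⟩; exact (hd i).1) (isFSup_iff_isLUB.2 hz)) hx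
  · rw [increasesTo_iff] at hl
    exact mem_nullIdeal_of_isLUB hF (T := ⟨T, hT⟩) (fun y hy => orderConverges_zero_iff.1
      (h y (orderConverges_zero_iff.2 hy))) hS hl.1 hl.2 fun n => (hx n).1
  · rw [orderConverges_zero_iff] at hx ⊢
    exact orderNull_map_of_nullIdeals hF (T := ⟨T, hT⟩) (fun S hS d z hd hz hd0 =>
      (h S hS).2 d z hd0 (increasesTo_iff.2 ⟨hd, hz⟩)) hx
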